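/- **Model.** Fix $n>2$ processes $\mathbb P=\{0,\dots,n-1\}$ and $1\le f<n$. Computation is synchronous: round $m+1$ takes place between times $m$ and $m+1$, and messages are received in the round in which they are sent. Each process $i$ has an initial value $v_i\in\{0,1\}$; its local state consists of $v_i$, the current time and what it has sent, received and done so far. A protocol prescribes, as a deterministic function of the local state, the messages that a process sends and the decisions that it performs. A process that crashes in round $m\ge 1$ behaves correctly in rounds $1,\dots,m-1$ (including its decisions up to time $m-1$), sends an arbitrary subset of its prescribed messages in round $m$, and does nothing from time $m$ on. $\gamma^f$ denotes this model with at most $f$ crashes per run. A run is *nice* if all initial values are $1$ and no process fails. "All" includes the sender itself, but what a process passes to itself is not counted as a message sent over the network. A protocol *solves atomic commitment (AC) in $\gamma^f$* if in all its runs in $\gamma^f$: every correct process eventually decides $\mathsf{commit}$ or $\mathsf{abort}$; all decisions performed (also by faulty processes) are the same; a process decides $\mathsf{commit}$ only if all initial values are $1$; a process decides $\mathsf{abort}$ only if some initial value is $0$ or some process fails. A protocol is a *biased-to-1 uniform consensus* on a set of runs if in these runs: only a proposed value is decided; no two processes decide differently; every correct process decides; and if some correct process proposes $1$, then only $1$ is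 decided. Let $\mathrm{Flood}(t)$ be the consensus protocol in which in each of rounds $1,\dots,t+1$ everybody sends its estimate ($1$ iff it proposed $1$ or has received a $1$) to all, and decides on its estimate at time $t+1$. **Protocol $\mathrm{D2}[C]$** with consensus subroutine $C$. Every process $i$ acts as follows. Round 1: if $v_i=1$, send `1' to $\{i,i+1,\dots,i+f\}\bmod n$. Round 2: if fewer than $f+1$ messages `1' were received, send `err' to all. Round 3: if no `err' was received in round 2, $\mathsf{commit}$ (at time $2$); otherwise send to all the id's of the processes from which `1' was received in round 1. Round 4 on: if no message was received in round 3, halt. Otherwise run $C$, starting in round 4, with proposal $1$ if all id's $0,\dots,n-1$ were received in round 3 or $\mathsf{commit}$ was performed, and proposal $0$ otherwise; if $\mathsf{commit}$ has not been performed at time 2, then $\mathsf{commit}$ when $C$ decides $1$ and $\mathsf{abort}$ when $C$ decides $0$. **Theorem.** 1. $\mathrm{Flood}(f-1)$ is a biased-to-1 uniform consensus in $\gamma^{f-1}$, and $\mathrm{D2}[\mathrm{Flood}(f-1)]$ solves AC in $\gamma^f$. More generally, $\mathrm{D2}[C]$ solves AC in $\gamma^f$ for every protocol $C$ that is a biased-to-1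 uniform consensus on those of its runs with at most $f$ crashes in which some process is dead from the start (it never sends anything) or all proposals are $0$. 2. For every $C$, in a nice run of $\mathrm{D2}[C]$ exactly $fn$ messages are sent over the network, every process performs $\mathsf{commit}$ at time $2$, and no other decision is performed. 3. This matches the lower bounds. Let $P$ be any protocol that solves AC in $\gamma^f$, and consider a nice run of $P$. If $f>1$, then no process decides before time $2$. If all processes decide by time $2$, then at least $fn$ messages are sent. -/

import Mathlib

namespace AtomicCommit

variable {n : ℕ} {M D : Type*}

/-! ## The synchronous message-passing model with crash failures -/

/-- Local state of a (non-crashed) process: its initial value and, for every completed round in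
order, the vector of messages received in that round (indexed by the sender). The current time is
the number of completed rounds. The messages sent and the actions performed so far are not recorded
separately: protocols are deterministic, so they are functions of this data. -/
@[ext] structure LocalState (n : ℕ) (M : Type*) where
  init : Bool
  history : List (Fin n → Option M)

/-- The current time. -/
def LocalState.time (s : LocalState n M) : ℕ := s.history.length

/-- The message received from `j` in round `k` (for `1 ≤ k`); `none` if there was none. -/
def LocalState.received (s : LocalState n M) (k : ℕ) (j : Fin n) : Option M :=
  s.history.getD (k - 1) (fun _ => none) j

/-- A deterministic protocol for `n` processes with messages in `M` and decisions in `D`.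
`send i s j` is the message (if any) which `i` sends to `j` in round `m + 1` and `decide i s` is the
decision (if any) which `i` performs at time `m`, when its local state at time `m` is `s`. -/
structure Protocol (n : ℕ) (M D : Type*) where
  send : Fin n → LocalState n M → Fin n → Option M
  decide : Fin n → LocalState n M → Option D

/-- The initial values and the failures of a run; together with a (deterministic) protocol it
determines the run. `crashRound i = ⊤` means that `i` never crashes; `reached i` contains the
processes to which the messages sent by `i` in its crashing round get through. -/
structure Scenario (n : ℕ) where
  init : Fin n → Bool
  crashRound : Fin n → ℕ∞
  one_le_crashRound : ∀ i, 1 ≤ crashRound i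
  reached : Fin n → Set (Fin n)

/-- Process `i` is faulty in the run. -/
def Scenario.Faulty (a : Scenario n) (i : Fin n) : Prop := a.crashRound i ≠ ⊤

/-- Nice runs: all initial values are `1` and no failure occurs. -/
def Scenario.Nice (a : Scenario n) : Prop := (∀ i, a.init i = true) ∧ ∀ i, ¬ a.Faulty i

/-- The context `γ^f`: at most `f` processes fail. -/
def context (n f : ℕ) : Set (Scenario n) := {a | {i | a.Faulty i}.ncard ≤ f}

open Classical in
/-- The message which is sent by `j` to `i` in round `m + 1`, when `st` are the local states at
time `m` (`none` for crashed processes). In its crashing round a process sends only those of the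
prescribed messages that go to `a.reached j`. -/
noncomputable def Protocol.roundMessage (P : Protocol n M D) (a : Scenario n) (m : ℕ)
    (st : Fin n → Option (LocalState n M)) (j i : Fin n) : Option M :=
  (st j).bind fun s =>
    if a.crashRound j = (m + 1 : ℕ) ∧ i ∉ a.reached j then none else P.send j s i

open Classical in
/-- The local states at time `m`. A process which crashes in round `k` has no local state
(`none`) from time `k` on. -/
noncomputable def Protocol.state (P : Protocol n M D) (a : Scenario n) :
    ℕ → Fin n → Option (LocalState n M)
  | 0, i => some ⟨a.init i, []⟩
  | m + 1, i =>
    if ((m + 1 : ℕ) : ℕ∞) < a.crashRound i then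
      (P.state a m i).map fun s =>
        ⟨s.init, s.history ++ [fun j => P.roundMessage a m (P.state a m) j i]⟩
    else none

/-- In the run, `i` sends a message to `j` in round `m + 1`. -/
def Protocol.Sends (P : Protocol n M D) (a : Scenario n) (m : ℕ) (i j : Fin n) : Prop :=
  P.roundMessage a m (P.state a m) i j ≠ none

/-- In the run, process `i` performs the decision `d` at time `m`. -/
def Protocol.Performs (P : Protocol n M D) (a : Scenario n) (i : Fin n) (d : D) (m : ℕ) : Prop :=
  ∃ s, P.state a m i = some s ∧ P.decide i s = some d

/-- The number of messages sent over the network in the whole run. What a process passes to itself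
is not sent over the network. -/
noncomputable def Protocol.messageCount (P : Protocol n M D) (a : Scenario n) : ℕ∞ :=
  {e : ℕ × Fin n × Fin n | e.2.1 ≠ e.2.2 ∧ P.Sends a e.1 e.2.1 e.2.2}.encard

/-! ## Atomic commitment and biased-to-1 uniform consensus -/

/-- The two possible decisions in atomic commitment. -/
inductive Decision
  | commit
  | abort

/-- All runs of `P` in `γ^f` satisfy the four conditions of atomic commitment. -/
structure SolvesAC (f : ℕ) (P : Protocol n M Decision) : Prop where
  decision : ∀ a ∈ context n f, ∀ i, ¬ a.Faulty i → ∃ d m, P.Performs a i d m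
  agreement : ∀ a ∈ context n f, ∀ i j d d' m m',
    P.Performs a i d m → P.Performs a j d' m' → d = d'
  commitValidity : ∀ a ∈ context n f, ∀ i m,
    P.Performs a i .commit m → ∀ j, a.init j = true
  abortValidity : ∀ a ∈ context n f, ∀ i m,
    P.Performs a i .abort m → (∃ j, a.init j = false) ∨ ∃ j, a.Faulty j

/-- All runs of `P` in the set of runs `R` satisfy the four conditions of biased-to-1 uniform
consensus; the initial values are the proposals. -/
structure IsB1Consensus (R : Set (Scenario n)) (P : Protocol n M Bool) : Prop where
  validity : ∀ a ∈ R, ∀ i b m, P.Performs a i b m → ∃ j, a.init j = b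
  agreement : ∀ a ∈ R, ∀ i j b b' m m', P.Performs a i b m → P.Performs a j b' m' → b = b'
  decision : ∀ a ∈ R, ∀ i, ¬ a.Faulty i → ∃ b m, P.Performs a i b m
  biased : ∀ a ∈ R, (∃ i, ¬ a.Faulty i ∧ a.init i = true) →
    ∀ i b m, P.Performs a i b m → b = true

/-- The runs of a consensus subroutine in which at most `f` processes crash and, moreover,
either at least one of them is dead from the start (it never sends anything), so that at most
`f - 1` crash during the execution, or all proposals are `0`. -/
def consensusRuns (n f : ℕ) : Set (Scenario n) :=
  {a | a ∈ context n f ∧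
    ((∃ j, a.crashRound j = 1 ∧ a.reached j = ∅) ∨ ∀ i, a.init i = false)}

open Classical in
/-- The estimate of a process in the flooding protocol: `1` iff it proposes `1` or has received
a `1`. -/
noncomputable def floodEstimate (s : LocalState n Bool) : Bool :=
  s.init || decide (∃ v ∈ s.history, ∃ j, v j = some true)

/-- `B.1.Consensus(t, ·)`: in each of the rounds `1, …, t + 1` everybody sends its estimate to all;
at time `t + 1` everybody decides on its estimate. -/
noncomputable def flood (n t : ℕ) : Protocol n Bool Bool where
  send _ s _ := if s.time ≤ t then some (floodEstimate s) else none
  decide _ s := if s.time = t + 1 then some (floodEstimate s) else none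

/-! ## The protocol D2 -/

/-- Messages of D2: `1`, the error message, a list of process id's, and the messages of the
consensus subroutine. -/
inductive D2Msg (n : ℕ) (M : Type*)
  | one
  | err
  | ids (I : Finset (Fin n))
  | cons (c : M)

/-- Extract a message of the consensus subroutine. -/
def D2Msg.toCons : D2Msg n M → Option M
  | .cons c => some c
  | _ => none

namespace D2

/-- `j ∈ {i, i+1, …, i+f} mod n`. -/
def IsTarget (f : ℕ) (i j : Fin n) : Prop := ∃ k ≤ f, (i.val + k) % n = j.val

open Classical in
/-- The processes from which `1` was received in round 1. -/
noncomputable def heardFrom (s : LocalState n (D2Msg n M)) : Finset (Fin n) :=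
  {j | s.received 1 j = some .one}

/-- An error message was received in round 2. -/
def GotErr (s : LocalState n (D2Msg n M)) : Prop := ∃ j, s.received 2 j = some .err

/-- Some message was received in round 3. -/
def Participates (s : LocalState n (D2Msg n M)) : Prop := ∃ j, s.received 3 j ≠ none

/-- All id's were received in round 3. -/
def GotAllIds (s : LocalState n (D2Msg n M)) : Prop :=
  ∀ k, ∃ j I, s.received 3 j = some (.ids I) ∧ k ∈ I

open Classical in
/-- The local state of the consensus subroutine, which starts in round 4. The proposal is `1` iff
all id's were received or `commit` was performed (which happens at time 2, iff no error message
was received in round 2). -/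
noncomputable def consState (s : LocalState n (D2Msg n M)) : LocalState n M where
  init := decide (GotAllIds s ∨ ¬ GotErr s)
  history := (s.history.drop 3).map fun v j => (v j).bind D2Msg.toCons

end D2

open Classical in
/-- The protocol D2 with failure bound `f` and consensus subroutine `C`. A process which receives no
message in round 3 halts: it neither sends nor decides from time 3 on. A process which has performed
`commit` at time 2 (i.e. without `GotErr`) may take part in the consensus, but does not decide
again. -/
noncomputable def D2 (f : ℕ) (C : Protocol n M Bool) : Protocol n (D2Msg n M) Decision where
  send i s j :=
    if s.time = 0 then
      if s.init = true ∧ D2.IsTarget f i j then some .one else none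
    else if s.time = 1 then
      if (D2.heardFrom s).card < f + 1 then some .err else none
    else if s.time = 2 then
      if D2.GotErr s then some (.ids (D2.heardFrom s)) else none
    else
      if D2.Participates s then (C.send i (D2.consState s) j).map .cons else none
  decide i s :=
    if s.time < 2 then none
    else if s.time = 2 then
      if D2.GotErr s then none else some .commit
    else
      if D2.Participates s ∧ D2.GotErr s then
        (C.decide i (D2.consState s)).map fun b => if b = true then .commit else .abort
      else none

end AtomicCommit

namespace AtomicCommit

variable {n : ℕ} {M D : Type*}

/-! Why D2 is safe: suppose `p` receives no error message. Correct processes report a missing `1` to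
everybody, so every correct process has heard from all its sources. Each process has `f + 1`
targets, one of them correct, so every id is heard by a correct process and all initial values are
`1`. If all correct processes received errors, they all send their id lists in round 3 and each of
them collects every id; otherwise a correct process has itself committed. In both cases a correct
process proposes `1`, and the bias of `C` forces the remaining decisions to be `commit`
(`exists_correct_proposes_one`).

From time 3 on, D2 simulates a run of `C`, described by `Scenario.inner` (`consState_view`). That
run meets the weak demand made on `C` (`inner_mem_consensusRuns`): either somebody crashed in rounds
1 to 3 and is dead for `C`, or these rounds were failure-free, the error stems from an initial value
`0`, and all proposals are `0`. Flooding for `f` rounds then suffices, since fewer than `f`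
processes crash without being dead, which leaves a round with no partial broadcast
(`exists_clean_round`).

The lower bounds compare two runs with the same correct survivor `w`. In one, `i` sees exactly a
nice run until it commits, and then it disappears together with all processes that could tell of its
input or of what it saw. In the other, some initial value is `0`. As `w` cannot distinguish them,
validity and agreement clash (`SolvesAC.false_of_indistinguishable`). -/

/-! ## Views: an explicit description of the local states -/

/-- The message from `j` to `i` that gets through in round `m + 1` of the run. -/
noncomputable def Protocol.msg (P : Protocol n M D) (a : Scenario n) (m : ℕ) (j i : Fin n) :
    Option M :=
  P.roundMessage a m (P.state a m) j i

/-- The local state which `i` has at time `m` if it has not crashed by then. -/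
noncomputable def Protocol.view (P : Protocol n M D) (a : Scenario n) (m : ℕ) (i : Fin n) :
    LocalState n M :=
  ⟨a.init i, (List.range m).map fun k j => P.msg a k j i⟩

/-- Messages sent by `j` in round `m + 1` to `i` get through. -/
def Scenario.Delivers (a : Scenario n) (m : ℕ) (j i : Fin n) : Prop :=
  (m : ℕ∞) < a.crashRound j ∧ (a.crashRound j = (m + 1 : ℕ) → i ∈ a.reached j)

namespace Protocol

variable (P : Protocol n M D) (a : Scenario n)

@[simp] theorem view_init (m : ℕ) (i : Fin n) : (P.view a m i).init = a.init i := rfl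

@[simp] theorem view_history_length (m : ℕ) (i : Fin n) :
    (P.view a m i).history.length = m := by simp [view]

@[simp] theorem view_time (m : ℕ) (i : Fin n) : (P.view a m i).time = m := by
  simp [LocalState.time]

theorem view_received {m k : ℕ} (h : k < m) (i j : Fin n) :
    (P.view a m i).received (k + 1) j = P.msg a k j i := by
  simp [view, LocalState.received, List.getD, h]

theorem view_zero (i : Fin n) : P.view a 0 i = ⟨a.init i, []⟩ := rfl

theorem view_succ (m : ℕ) (i : Fin n) :
    P.view a (m + 1) i = ⟨a.init i, (P.view a m i).history ++ [fun j => P.msg a m j i]⟩ := by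
  simp [view, List.range_succ]

-- Views are total, defined for crashed processes too. Crashing is thereby separated from the
-- content of a state, and runs can be compared view by view.
open Classical in
theorem state_eq (m : ℕ) (i : Fin n) :
    P.state a m i = if (m : ℕ∞) < a.crashRound i then some (P.view a m i) else none := by
  induction m with
  | zero =>
    have : (0 : ℕ∞) < a.crashRound i := lt_of_lt_of_le (by simp) (a.one_le_crashRound i)
    simp [state, view_zero, this]
  | succ m ih =>
    rw [state]
    split_ifs with h
    · have : (m : ℕ∞) < a.crashRound i := lt_trans (by exact_mod_cast m.lt_succ_self) h
      rw [ih, if_pos this, view_succ]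
      rfl
    · rfl

open Classical in
theorem msg_eq (m : ℕ) (j i : Fin n) :
    P.msg a m j i = if a.Delivers m j i then P.send j (P.view a m j) i else none := by
  rw [msg, roundMessage, state_eq]
  unfold Scenario.Delivers
  by_cases h : (m : ℕ∞) < a.crashRound j
  · rw [if_pos h, Option.bind_some]
    by_cases h1 : a.crashRound j = (m + 1 : ℕ) ∧ i ∉ a.reached j
    · rw [if_pos h1, if_neg fun h' => h1.2 (h'.2 h1.1)]
    · rw [if_neg h1, if_pos ⟨h, fun e => by_contra fun h' => h1 ⟨e, h'⟩⟩]
  · rw [if_neg h, if_neg fun h' => h h'.1, Option.bind_none]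

theorem msg_of_delivers {m : ℕ} {j i : Fin n} (h : a.Delivers m j i) :
    P.msg a m j i = P.send j (P.view a m j) i := by
  rw [msg_eq, if_pos h]

theorem msg_of_not_delivers {m : ℕ} {j i : Fin n} (h : ¬ a.Delivers m j i) :
    P.msg a m j i = none := by
  rw [msg_eq, if_neg h]

theorem msg_eq_some_iff {m : ℕ} {j i : Fin n} {c : M} :
    P.msg a m j i = some c ↔ a.Delivers m j i ∧ P.send j (P.view a m j) i = some c := by
  rw [msg_eq]; split_ifs with h <;> simp [h]

theorem performs_iff (i : Fin n) (d : D) (m : ℕ) :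
    P.Performs a i d m ↔ (m : ℕ∞) < a.crashRound i ∧ P.decide i (P.view a m i) = some d := by
  unfold Performs
  rw [state_eq]
  split_ifs with h <;> simp [h]

theorem sends_iff (m : ℕ) (i j : Fin n) : P.Sends a m i j ↔ P.msg a m i j ≠ none := Iff.rfl

variable {P a}

theorem view_succ_congr {b : Scenario n} {m : ℕ} {i : Fin n}
    (h : P.view a m i = P.view b m i) (hm : ∀ j, P.msg a m j i = P.msg b m j i) :
    P.view a (m + 1) i = P.view b (m + 1) i := by
  have h0 : a.init i = b.init i := congrArg LocalState.init h
  rw [view_succ, view_succ, h, h0, funext hm]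

/-- If the views of the sender agree and the messages get through in both or in none of the runs,
then the same message arrives. -/
theorem msg_congr {b : Scenario n} {m : ℕ} {j i : Fin n}
    (h : P.view a m j = P.view b m j) (hd : a.Delivers m j i ↔ b.Delivers m j i) :
    P.msg a m j i = P.msg b m j i := by
  rw [msg_eq, msg_eq, h]
  by_cases h' : b.Delivers m j i <;> simp [hd, h']

end Protocol

/-! ### Crashes, delivery and the existence of correct processes -/

namespace Scenario

variable {a : Scenario n}

theorem crashRound_eq_top {i : Fin n} (h : ¬ a.Faulty i) : a.crashRound i = ⊤ := not_not.1 h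

theorem lt_crashRound_of_not_faulty {i : Fin n} (h : ¬ a.Faulty i) (m : ℕ) :
    (m : ℕ∞) < a.crashRound i := by
  rw [crashRound_eq_top h]; exact ENat.natCast_lt_top m

theorem delivers_of_succ_lt {m : ℕ} {j : Fin n} (h : ((m + 1 : ℕ) : ℕ∞) < a.crashRound j)
    (i : Fin n) : a.Delivers m j i :=
  ⟨lt_trans (by exact_mod_cast m.lt_succ_self) h, fun e => absurd e h.ne'⟩

theorem delivers_of_not_faulty {j : Fin n} (h : ¬ a.Faulty j) (m : ℕ) (i : Fin n) :
    a.Delivers m j i :=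
  delivers_of_succ_lt (lt_crashRound_of_not_faulty h _) i

theorem lt_crashRound_of_le {m k : ℕ} {j : Fin n} (hk : k ≤ m) (h : (m : ℕ∞) < a.crashRound j) :
    (k : ℕ∞) < a.crashRound j :=
  lt_of_le_of_lt (by exact_mod_cast hk) h

/-- With at most `f` failures, every set of more than `f` processes contains a correct one. -/
theorem exists_not_faulty {f : ℕ} (ha : a ∈ context n f) {s : Finset (Fin n)} (hs : f < s.card) :
    ∃ i ∈ s, ¬ a.Faulty i := by
  by_contra! h
  have : (s : Set (Fin n)).ncard ≤ {i | a.Faulty i}.ncard :=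
    Set.ncard_le_ncard (fun i hi => h i hi) (Set.toFinite _)
  rw [Set.ncard_coe_finset] at this
  have h2 : {i | a.Faulty i}.ncard ≤ f := ha
  omega

theorem exists_correct {f : ℕ} (hfn : f < n) (ha : a ∈ context n f) : ∃ i, ¬ a.Faulty i := by
  obtain ⟨i, -, hi⟩ := exists_not_faulty ha (s := Finset.univ) (by simpa using hfn)
  exact ⟨i, hi⟩

theorem Nice.mem_context (h : a.Nice) (f : ℕ) : a ∈ context n f := by
  have : {i | a.Faulty i} = ∅ := by ext i; simpa using h.2 i
  simp [context, this]

end Scenario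

/-! ## Flooding -/

/-- Process `i` is dead from the start: it never sends anything. -/
def Scenario.Dead (a : Scenario n) (i : Fin n) : Prop := a.crashRound i = 1 ∧ a.reached i = ∅

section Flood

variable {a : Scenario n} {t : ℕ}

/-- The estimate of process `i` at time `m`. -/
noncomputable def floodEst (a : Scenario n) (t m : ℕ) (i : Fin n) : Bool :=
  floodEstimate ((flood n t).view a m i)

theorem floodEst_eq_true_iff (m : ℕ) (i : Fin n) :
    floodEst a t m i = true ↔
      a.init i = true ∨ ∃ k < m, ∃ j, (flood n t).msg a k j i = some true := by
  simp only [floodEst, floodEstimate, Protocol.view_init, Bool.or_eq_true, decide_eq_true_eq]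
  simp [Protocol.view]

theorem flood_msg_eq_true_iff (m : ℕ) (j i : Fin n) :
    (flood n t).msg a m j i = some true ↔
      m ≤ t ∧ a.Delivers m j i ∧ floodEst a t m j = true := by
  rw [Protocol.msg_eq_some_iff]
  simp only [flood, Protocol.view_time, floodEst]
  by_cases h : m ≤ t <;> simp [h]

theorem floodEst_succ (m : ℕ) (i : Fin n) :
    floodEst a t (m + 1) i = true ↔
      floodEst a t m i = true ∨ m ≤ t ∧ ∃ j, a.Delivers m j i ∧ floodEst a t m j = true := by
  rw [floodEst_eq_true_iff, floodEst_eq_true_iff]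
  constructor
  · rintro (h | ⟨k, hk, j, h⟩)
    · exact .inl (.inl h)
    · rcases Nat.lt_succ_iff_lt_or_eq.1 hk with hk | rfl
      · exact .inl (.inr ⟨k, hk, j, h⟩)
      · rw [flood_msg_eq_true_iff] at h
        exact .inr ⟨h.1, j, h.2⟩
  · rintro ((h | ⟨k, hk, j, h⟩) | ⟨hm, j, h⟩)
    · exact .inl h
    · exact .inr ⟨k, by omega, j, h⟩
    · exact .inr ⟨m, by omega, j, (flood_msg_eq_true_iff _ _ _).2 ⟨hm, h⟩⟩

theorem floodEst_of_init {i : Fin n} (h : a.init i = true) (m : ℕ) : floodEst a t m i = true :=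
  (floodEst_eq_true_iff _ _).2 (.inl h)

theorem exists_init_of_floodEst {m : ℕ} {i : Fin n} (h : floodEst a t m i = true) :
    ∃ j, a.init j = true := by
  induction m generalizing i with
  | zero => exact ⟨i, by simpa [floodEst_eq_true_iff] using h⟩
  | succ m ih =>
    rcases (floodEst_succ _ _).1 h with h | ⟨-, j, -, h⟩
    · exact ih h
    · exact ih h

theorem flood_performs_iff (i : Fin n) (b : Bool) (m : ℕ) :
    (flood n t).Performs a i b m ↔
      m = t + 1 ∧ ((t + 1 : ℕ) : ℕ∞) < a.crashRound i ∧ floodEst a t (t + 1) i = b := by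
  rw [Protocol.performs_iff]
  simp only [flood, Protocol.view_time, floodEst]
  by_cases h : m = t + 1
  · subst h; simp
  · simp [h]

/-- All processes which are alive at time `m` have the same estimate. -/
def FloodUniform (a : Scenario n) (t m : ℕ) : Prop :=
  ∀ i j, (m : ℕ∞) < a.crashRound i → (m : ℕ∞) < a.crashRound j →
    floodEst a t m i = true → floodEst a t m j = true

theorem FloodUniform.succ {m : ℕ} (h : FloodUniform a t m) : FloodUniform a t (m + 1) := by
  intro i j hi hj he
  rw [floodEst_succ] at he ⊢
  have hj' := Scenario.lt_crashRound_of_le m.le_succ hj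
  rcases he with he | ⟨-, k, hk, he⟩
  · exact .inl (h i j (Scenario.lt_crashRound_of_le m.le_succ hi) hj' he)
  · exact .inl (h k j hk.1 hj' he)

theorem FloodUniform.of_le {m k : ℕ} (h : FloodUniform a t m) (hk : m ≤ k) :
    FloodUniform a t k := by
  induction hk with
  | refl => exact h
  | step _ ih => exact ih.succ

/-- A round in which no sender is interrupted makes the estimates equal. -/
theorem floodUniform_of_clean {m : ℕ} (hm : m ≤ t)
    (h : ∀ i, a.crashRound i = (m + 1 : ℕ) → a.reached i = ∅) : FloodUniform a t (m + 1) := by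
  have key : ∀ k i j, a.Delivers m k i → a.Delivers m k j := by
    intro k i j hk
    refine ⟨hk.1, fun e => ?_⟩
    have := hk.2 e
    simp [h k e] at this
  intro i j hi hj he
  rw [floodEst_succ] at he ⊢
  rcases he with he | ⟨-, k, hk, he⟩
  -- A process alive after the round has completed its broadcast, so `j` hears from `i` itself.
  · exact .inr ⟨hm, i, Scenario.delivers_of_succ_lt hi j, he⟩
  · exact .inr ⟨hm, k, key k i j hk, he⟩

/-- Pigeonhole: a process crashes only once, so partial broadcasts in all `t + 1` rounds would need
`t + 1` different faulty processes. None of these is dead, as each reaches somebody. -/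
theorem exists_clean_round (h : {i | a.Faulty i ∧ ¬ a.Dead i}.ncard ≤ t) :
    ∃ m ≤ t, ∀ i, a.crashRound i = (m + 1 : ℕ) → a.reached i = ∅ := by
  by_contra! hc
  have hc' : ∀ m : Fin (t + 1), ∃ i, a.crashRound i = (m.val + 1 : ℕ) ∧ a.reached i ≠ ∅ :=
    fun m => by simpa [Set.nonempty_iff_ne_empty] using hc m.val (by omega)
  choose g hg hg' using hc'
  have hinj : Function.Injective g := by
    intro x y hxy
    have := (hg x).symm.trans ((congrArg a.crashRound hxy).trans (hg y))
    have : x.val + 1 = y.val + 1 := by exact_mod_cast this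
    exact Fin.ext (by omega)
  have hsub : Set.range g ⊆ {i | a.Faulty i ∧ ¬ a.Dead i} := by
    rintro _ ⟨x, rfl⟩
    refine ⟨?_, fun hd => hg' x hd.2⟩
    rw [Scenario.Faulty, hg]
    exact ENat.natCast_ne_top _
  have := Set.ncard_le_ncard hsub (Set.toFinite _)
  rw [← Set.image_univ, Set.ncard_image_of_injective _ hinj, Set.ncard_univ] at this
  simp at this
  omega

/-- The set of runs is wide enough for both uses of flooding. Dead processes never spoil a round, so
they are not counted; if all proposals are `0`, no estimate ever becomes `1`. -/
theorem flood_isB1Consensus (n t : ℕ) :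
    IsB1Consensus
      {a : Scenario n | {i | a.Faulty i ∧ ¬ a.Dead i}.ncard ≤ t ∨ ∀ i, a.init i = false}
      (flood n t) where
  validity a _ i b m h := by
    obtain ⟨-, -, rfl⟩ := (flood_performs_iff _ _ _).1 h
    cases hb : floodEst a t (t + 1) i with
    | true => exact exists_init_of_floodEst hb
    | false =>
      refine ⟨i, ?_⟩
      by_contra hi
      simp [floodEst_of_init (by simpa using hi)] at hb
  agreement a ha i j b b' m m' h h' := by
    obtain ⟨-, hi, rfl⟩ := (flood_performs_iff _ _ _).1 h
    obtain ⟨-, hj, rfl⟩ := (flood_performs_iff _ _ _).1 h'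
    have hu : FloodUniform a t (t + 1) := by
      rcases ha with ha | ha
      · obtain ⟨m, hm, hc⟩ := exists_clean_round ha
        exact (floodUniform_of_clean hm hc).of_le (by omega)
      · intro i j _ _ he
        obtain ⟨k, hk⟩ := exists_init_of_floodEst he
        simp [ha k] at hk
    exact Bool.eq_iff_iff.2 ⟨hu i j hi hj, hu j i hj hi⟩
  decision a _ i hi :=
    ⟨_, _, (flood_performs_iff _ _ _).2 ⟨rfl, Scenario.lt_crashRound_of_not_faulty hi _, rfl⟩⟩
  biased a ha hc i b m h := by
    obtain ⟨-, hi, rfl⟩ := (flood_performs_iff _ _ _).1 h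
    obtain ⟨c, hc, hc1⟩ := hc
    rw [floodEst_succ]
    -- The last flooding round alone suffices: the correct proposer `c` reaches everybody in it.
    exact .inr ⟨le_rfl, c, Scenario.delivers_of_not_faulty hc _ _, floodEst_of_init hc1 _⟩

end Flood

theorem IsB1Consensus.mono {R S : Set (Scenario n)} {C : Protocol n M Bool}
    (h : IsB1Consensus S C) (hRS : R ⊆ S) : IsB1Consensus R C where
  validity a ha := h.validity a (hRS ha)
  agreement a ha := h.agreement a (hRS ha)
  decision a ha := h.decision a (hRS ha)
  biased a ha := h.biased a (hRS ha)

theorem flood_isB1Consensus_context (n t : ℕ) : IsB1Consensus (context n t) (flood n t) :=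
  (flood_isB1Consensus n t).mono fun _ ha =>
    .inl ((Set.ncard_le_ncard (fun _ hi => hi.1) (Set.toFinite _)).trans ha)

/-- A dead process is faulty but not counted, so at most `f - 1` harmful crashes remain. -/
theorem flood_isB1Consensus_consensusRuns (n f : ℕ) :
    IsB1Consensus (consensusRuns n f) (flood n (f - 1)) := by
  refine (flood_isB1Consensus n (f - 1)).mono ?_
  rintro a ⟨ha, ⟨j, hj⟩ | h0⟩
  · refine .inl (Nat.le_sub_one_of_lt (lt_of_lt_of_le (Set.ncard_lt_ncard ?_ (Set.toFinite _)) ha))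
    refine Set.ssubset_iff_of_subset (fun _ hi => hi.1) |>.2 ⟨j, ?_, fun h => h.2 hj⟩
    simp [Scenario.Faulty, hj.1]
  · exact .inr h0

/-! ## Targets -/

namespace D2

/-- With cyclic subtraction, the targets of `i` are a translate and the sources of `j` a reflected
translate of `{x | x ≤ f}`. Both therefore have `f + 1` elements. -/
theorem isTarget_iff [NeZero n] {f : ℕ} (hfn : f < n) (i j : Fin n) :
    IsTarget f i j ↔ (j - i).val ≤ f := by
  constructor
  · rintro ⟨k, hk, h⟩
    have : j = i + ⟨k, by omega⟩ := by ext; simp [Fin.val_add, h]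
    rw [this]
    simpa using hk
  · intro h
    refine ⟨(j - i).val, h, ?_⟩
    rw [← Fin.val_add]; simp

theorem card_le (n f : ℕ) (hfn : f < n) :
    (Finset.univ.filter fun x : Fin n => x.val ≤ f).card = f + 1 := by
  have : (Finset.univ.filter fun x : Fin n => x.val ≤ f) = Finset.Iic ⟨f, hfn⟩ := by
    ext x; simp [Fin.le_def]
  rw [this, Fin.card_Iic]

open Classical in
theorem card_targets {f : ℕ} (hfn : f < n) (i : Fin n) :
    (Finset.univ.filter fun j => IsTarget f i j).card = f + 1 := by
  have : NeZero n := ⟨by omega⟩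
  rw [← card_le n f hfn]
  refine Finset.card_equiv (Equiv.subRight i) fun j => ?_
  simp [isTarget_iff hfn]

open Classical in
theorem card_sources {f : ℕ} (hfn : f < n) (j : Fin n) :
    (Finset.univ.filter fun i => IsTarget f i j).card = f + 1 := by
  have : NeZero n := ⟨by omega⟩
  rw [← card_le n f hfn]
  refine Finset.card_equiv (Equiv.subLeft j) fun i => ?_
  simp [isTarget_iff hfn]

theorem isTarget_self (f : ℕ) (i : Fin n) : IsTarget f i i :=
  ⟨0, by omega, by simp [Nat.mod_eq_of_lt i.isLt]⟩

end D2

/-! ## The run of D2 up to time 3 -/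

section Run

variable {f : ℕ} {C : Protocol n M Bool} {a : Scenario n}

open Classical in
/-- The processes whose `1` arrives at `i` in round 1. -/
noncomputable def heard (a : Scenario n) (f : ℕ) (i : Fin n) : Finset (Fin n) :=
  {j | a.init j = true ∧ D2.IsTarget f j i ∧ a.Delivers 0 j i}

/-- An error message arrives at `i` in round 2. -/
def ErrAt (a : Scenario n) (f : ℕ) (i : Fin n) : Prop :=
  ∃ j, a.Delivers 1 j i ∧ (heard a f j).card < f + 1

/-- Process `i` receives some message in round 3. -/
def Active (a : Scenario n) (f : ℕ) (i : Fin n) : Prop :=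
  ∃ j, a.Delivers 2 j i ∧ ErrAt a f j

/-- Process `i` receives all id's in round 3. -/
def AllIdsAt (a : Scenario n) (f : ℕ) (i : Fin n) : Prop :=
  ∀ k, ∃ j, a.Delivers 2 j i ∧ ErrAt a f j ∧ k ∈ heard a f j

theorem D2_send_zero {s : LocalState n (D2Msg n M)} (h : s.time = 0) (i j : Fin n) :
    (D2 f C).send i s j = some .one ↔ s.init = true ∧ D2.IsTarget f i j := by
  simp [D2, h]

open Classical in
theorem D2_send_one {s : LocalState n (D2Msg n M)} (h : s.time = 1) (i j : Fin n) :
    (D2 f C).send i s j = if (D2.heardFrom s).card < f + 1 then some .err else none := by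
  simp [D2, h]

open Classical in
theorem D2_send_two {s : LocalState n (D2Msg n M)} (h : s.time = 2) (i j : Fin n) :
    (D2 f C).send i s j = if D2.GotErr s then some (.ids (D2.heardFrom s)) else none := by
  simp [D2, h]

open Classical in
theorem D2_send_late {s : LocalState n (D2Msg n M)} (h : 3 ≤ s.time) (i j : Fin n) :
    (D2 f C).send i s j =
      if D2.Participates s then (C.send i (D2.consState s) j).map .cons else none := by
  simp only [D2, show ¬ s.time = 0 by omega, show ¬ s.time = 1 by omega,
    show ¬ s.time = 2 by omega, if_false]

theorem D2_decide_iff (s : LocalState n (D2Msg n M)) (i : Fin n) (d : Decision) :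
    (D2 f C).decide i s = some d ↔
      (s.time = 2 ∧ ¬ D2.GotErr s ∧ d = .commit ∨
        3 ≤ s.time ∧ D2.Participates s ∧ D2.GotErr s ∧ ∃ b,
          C.decide i (D2.consState s) = some b ∧ d = if b = true then .commit else .abort) := by
  simp only [D2]
  rcases lt_trichotomy s.time 2 with h | h | h
  · simp [h, show ¬ s.time = 2 by omega, show ¬ 3 ≤ s.time by omega]
  · rw [h]
    by_cases he : D2.GotErr s <;> simp [he, eq_comm]
  · have h3 : 3 ≤ s.time := h
    simp only [show ¬ s.time < 2 by omega, show ¬ s.time = 2 by omega,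
      if_false, false_and, false_or, h3, true_and]
    by_cases he : D2.Participates s ∧ D2.GotErr s
    · rw [if_pos he]
      simp [he.1, he.2, eq_comm]
    · rw [if_neg he]
      simp only [reduceCtorEq, false_iff]
      tauto

theorem D2_msg_zero (j i : Fin n) :
    (D2 f C).msg a 0 j i = some .one ↔ j ∈ heard a f i := by
  rw [Protocol.msg_eq_some_iff, D2_send_zero (by simp)]
  simp only [heard, Protocol.view_init, Finset.mem_filter, Finset.mem_univ, true_and]
  tauto

/-- The first three rounds do not involve `C`, so what they bring about is a function of the
scenario and `f` alone. -/
theorem heardFrom_view {m : ℕ} (hm : 1 ≤ m) (i : Fin n) :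
    D2.heardFrom ((D2 f C).view a m i) = heard a f i := by
  classical
  ext j
  have := Protocol.view_received (D2 f C) a (show 0 < m by omega) i j
  rw [zero_add] at this
  simp only [D2.heardFrom, Finset.mem_filter, Finset.mem_univ, true_and]
  rw [this, D2_msg_zero]

open Classical in
theorem D2_msg_one (j i : Fin n) :
    (D2 f C).msg a 1 j i = if a.Delivers 1 j i ∧ (heard a f j).card < f + 1
      then some .err else none := by
  rw [Protocol.msg_eq, D2_send_one (by simp), heardFrom_view le_rfl, ite_and]

theorem gotErr_view {m : ℕ} (hm : 2 ≤ m) (i : Fin n) :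
    D2.GotErr ((D2 f C).view a m i) ↔ ErrAt a f i := by
  refine exists_congr fun j => ?_
  have := Protocol.view_received (D2 f C) a (show 1 < m by omega) i j
  rw [show 2 = 1 + 1 from rfl, this, D2_msg_one]
  split_ifs with h
  · simp only [h, and_self]
  · simp only [h]

open Classical in
theorem D2_msg_two (j i : Fin n) :
    (D2 f C).msg a 2 j i = if a.Delivers 2 j i ∧ ErrAt a f j
      then some (.ids (heard a f j)) else none := by
  rw [Protocol.msg_eq, D2_send_two (by simp), heardFrom_view one_le_two, ite_and]
  simp only [gotErr_view le_rfl]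

theorem participates_view {m : ℕ} (hm : 3 ≤ m) (i : Fin n) :
    D2.Participates ((D2 f C).view a m i) ↔ Active a f i := by
  refine exists_congr fun j => ?_
  have := Protocol.view_received (D2 f C) a (show 2 < m by omega) i j
  rw [show 3 = 2 + 1 from rfl, this, D2_msg_two]
  split_ifs with h <;> simp [h]

theorem gotAllIds_view {m : ℕ} (hm : 3 ≤ m) (i : Fin n) :
    D2.GotAllIds ((D2 f C).view a m i) ↔ AllIdsAt a f i := by
  refine forall_congr' fun k => exists_congr fun j => ?_
  have := Protocol.view_received (D2 f C) a (show 2 < m by omega) i j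
  rw [show 3 = 2 + 1 from rfl, this, D2_msg_two]
  split_ifs with h
  · simp [h]
  · simp; tauto

theorem D2_performs_iff (i : Fin n) (d : Decision) (m : ℕ) :
    (D2 f C).Performs a i d m ↔ (m : ℕ∞) < a.crashRound i ∧
      (m = 2 ∧ ¬ ErrAt a f i ∧ d = .commit ∨
        3 ≤ m ∧ Active a f i ∧ ErrAt a f i ∧ ∃ b,
          C.decide i (D2.consState ((D2 f C).view a m i)) = some b ∧
          d = if b = true then .commit else .abort) := by
  rw [Protocol.performs_iff, D2_decide_iff, Protocol.view_time]
  refine and_congr_right fun _ => or_congr ?_ ?_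
  · exact and_congr_right fun h => by rw [gotErr_view h.ge]
  · exact and_congr_right fun h => by rw [gotErr_view (by omega), participates_view h]

open Classical in
theorem D2_msg_late {m : ℕ} (hm : 3 ≤ m) (j i : Fin n) :
    (D2 f C).msg a m j i = if a.Delivers m j i ∧ Active a f j
      then (C.send j (D2.consState ((D2 f C).view a m j)) i).map .cons else none := by
  rw [Protocol.msg_eq, D2_send_late (by simpa using hm), ite_and]
  simp only [participates_view hm]

/-- If `i` hears from fewer than `f + 1` processes, then the `1` of some of its sources is
missing. -/
theorem exists_missing (hfn : f < n) {i : Fin n} (h : (heard a f i).card < f + 1) :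
    ∃ j, D2.IsTarget f j i ∧ ¬ (a.init j = true ∧ a.Delivers 0 j i) := by
  classical
  by_contra! hc
  refine h.ne ?_
  rw [← D2.card_sources hfn i]
  congr 1
  ext j
  have := hc j
  simp only [heard, Finset.mem_filter]
  tauto

/-- A process hears only from its sources, and there are exactly `f + 1` of them, so the cardinality
forces equality. -/
theorem mem_heard_of_card (hfn : f < n) {i : Fin n} (h : ¬ (heard a f i).card < f + 1)
    {j : Fin n} (hj : D2.IsTarget f j i) : j ∈ heard a f i := by
  classical
  have hsub : heard a f i ⊆ Finset.univ.filter fun j => D2.IsTarget f j i := fun j hj => by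
    simp only [heard, Finset.mem_filter] at hj
    simp [hj.2.2.1]
  have : heard a f i = Finset.univ.filter fun j => D2.IsTarget f j i :=
    Finset.eq_of_subset_of_card_le hsub (by rw [D2.card_sources hfn]; omega)
  rw [this]; simp [hj]

theorem init_of_mem_heard {i j : Fin n} (h : j ∈ heard a f i) : a.init j = true := by
  simp only [heard, Finset.mem_filter] at h
  exact h.2.1

/-- If `p` receives no error message, then every correct process hears from all its sources. -/
theorem heard_full_of_not_errAt {p w : Fin n} (hp : ¬ ErrAt a f p) (hw : ¬ a.Faulty w) :
    ¬ (heard a f w).card < f + 1 :=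
  fun h => hp ⟨w, Scenario.delivers_of_not_faulty hw _ _, h⟩

/-- If `p` receives no error message, then every process is heard by some correct process. -/
theorem exists_correct_hearer (hfn : f < n) (ha : a ∈ context n f) {p : Fin n}
    (hp : ¬ ErrAt a f p) (k : Fin n) : ∃ j, ¬ a.Faulty j ∧ k ∈ heard a f j := by
  classical
  obtain ⟨j, hj, hc⟩ := Scenario.exists_not_faulty ha
    (s := Finset.univ.filter fun j => D2.IsTarget f k j) (by rw [D2.card_targets hfn]; omega)
  exact ⟨j, hc, mem_heard_of_card hfn (heard_full_of_not_errAt hp hc) (by simpa using hj)⟩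

theorem init_of_not_errAt (hfn : f < n) (ha : a ∈ context n f) {p : Fin n}
    (hp : ¬ ErrAt a f p) (k : Fin n) : a.init k = true := by
  obtain ⟨j, -, hj⟩ := exists_correct_hearer hfn ha hp k
  exact init_of_mem_heard hj

end Run

/-! ## The run of the consensus subroutine inside a run of D2 -/

open Classical in
/-- The run of the consensus subroutine inside a run of D2: the processes which have crashed by
time 3 are dead from the start. -/
noncomputable def Scenario.inner (a : Scenario n) (f : ℕ) : Scenario n where
  init i := decide ((3 : ℕ) < a.crashRound i ∧ (AllIdsAt a f i ∨ ¬ ErrAt a f i))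
  crashRound i := if (3 : ℕ) < a.crashRound i then a.crashRound i - 3 else 1
  one_le_crashRound i := by
    split_ifs with h
    · cases hc : a.crashRound i with
      | top => simp
      | coe c =>
        rw [hc] at h
        have : 3 < c := by exact_mod_cast h
        exact_mod_cast (by omega : 1 ≤ c - 3)
    · exact le_rfl
  reached i := if (3 : ℕ) < a.crashRound i then a.reached i else ∅

section Inner

variable {f : ℕ} {C : Protocol n M Bool} {a : Scenario n}

theorem inner_lt_crashRound_iff {m : ℕ} {i : Fin n} (hi : ((3 : ℕ) : ℕ∞) < a.crashRound i) :
    (m : ℕ∞) < (a.inner f).crashRound i ↔ ((m + 3 : ℕ) : ℕ∞) < a.crashRound i := by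
  simp only [Scenario.inner, hi, if_true]
  cases hc : a.crashRound i with
  | top => exact iff_of_true (ENat.natCast_lt_top m) (ENat.natCast_lt_top _)
  | coe c =>
    have : ((c : ℕ∞) - 3) = ((c - 3 : ℕ) : ℕ∞) := by push_cast; rfl
    rw [this, ENat.natCast_lt_natCast, ENat.natCast_lt_natCast]
    omega

theorem inner_crashRound_eq_iff {m : ℕ} {i : Fin n} (hi : ((3 : ℕ) : ℕ∞) < a.crashRound i) :
    (a.inner f).crashRound i = (m + 1 : ℕ) ↔ a.crashRound i = (m + 3 + 1 : ℕ) := by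
  simp only [Scenario.inner, hi, if_true]
  cases hc : a.crashRound i with
  | top => exact iff_of_false (ENat.top_ne_natCast _) (ENat.top_ne_natCast _)
  | coe c =>
    have : ((c : ℕ∞) - 3) = ((c - 3 : ℕ) : ℕ∞) := by push_cast; rfl
    rw [this]
    norm_cast
    omega

/-- For survivors this is a shift by three rounds. For the others `reached` has to be empty in
`inner`, since otherwise their crash in its first round could let messages through. -/
theorem inner_delivers_iff (m : ℕ) (j i : Fin n) :
    (a.inner f).Delivers m j i ↔ a.Delivers (m + 3) j i := by
  by_cases hj : ((3 : ℕ) : ℕ∞) < a.crashRound j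
  · unfold Scenario.Delivers
    rw [inner_lt_crashRound_iff hj, inner_crashRound_eq_iff hj]
    simp only [Scenario.inner, hj, if_true]
  · refine iff_of_false (fun h => ?_)
      (fun h => hj (Scenario.lt_crashRound_of_le (by omega) h.1))
    have h1 : (a.inner f).crashRound j = 1 := by simp only [Scenario.inner, hj, if_false]
    have h2 : (a.inner f).reached j = ∅ := by simp only [Scenario.inner, hj, if_false]
    obtain ⟨h3, h4⟩ := h
    rw [h1] at h3 h4
    have : m < 1 := by exact_mod_cast h3
    obtain rfl : m = 0 := by omega
    simpa [h2] using h4 (by simp)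

theorem inner_faulty_iff (i : Fin n) : (a.inner f).Faulty i ↔ a.Faulty i := by
  by_cases hi : ((3 : ℕ) : ℕ∞) < a.crashRound i
  · simp only [Scenario.Faulty, Scenario.inner, hi, if_true]
    cases hc : a.crashRound i with
    | top => simp
    | coe c =>
      have : ((c : ℕ∞) - 3) = ((c - 3 : ℕ) : ℕ∞) := by push_cast; rfl
      rw [this]
      simp
  · simp only [Scenario.Faulty, Scenario.inner, hi, if_false]
    refine iff_of_true (by simp) fun h => hi ?_
    rw [h]; exact ENat.natCast_lt_top 3

theorem inner_init_iff (i : Fin n) : (a.inner f).init i = true ↔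
    ((3 : ℕ) : ℕ∞) < a.crashRound i ∧ (AllIdsAt a f i ∨ ¬ ErrAt a f i) := by
  simp [Scenario.inner]

theorem inner_dead {i : Fin n} (hi : ¬ ((3 : ℕ) : ℕ∞) < a.crashRound i) :
    (a.inner f).crashRound i = 1 ∧ (a.inner f).reached i = ∅ := by
  simp only [Scenario.inner, hi, if_false, and_self]

/-- A survivor that received an error sends its list to everybody in round 3. Hence, as soon as one
process depends on `C`, nobody halts and `C` runs with all survivors. -/
theorem active_of_errAt {p : Fin n} (hp : ((3 : ℕ) : ℕ∞) < a.crashRound p) (he : ErrAt a f p)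
    (i : Fin n) : Active a f i :=
  ⟨p, Scenario.delivers_of_succ_lt hp i, he⟩

theorem consState_view_init (m : ℕ) {i : Fin n} (hi : ((3 : ℕ) : ℕ∞) < a.crashRound i) :
    (D2.consState ((D2 f C).view a (m + 3) i)).init = (a.inner f).init i := by
  rw [Bool.eq_iff_iff, inner_init_iff]
  simp only [D2.consState, decide_eq_true_eq]
  rw [gotAllIds_view (by omega), gotErr_view (by omega), and_iff_right hi]

/-- The simulation, by induction on rounds: all senders take part, deliveries match up to the shift,
and `D2Msg.toCons` undoes the wrapping of messages. -/
theorem consState_view (hact : ∀ i, Active a f i) (m : ℕ) (i : Fin n)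
    (hi : ((3 : ℕ) : ℕ∞) < a.crashRound i) :
    D2.consState ((D2 f C).view a (m + 3) i) = C.view (a.inner f) m i := by
  induction m generalizing i with
  | zero =>
    refine LocalState.ext (consState_view_init 0 hi) ?_
    simp [D2.consState, Protocol.view_zero]
  | succ m ih =>
    refine LocalState.ext (consState_view_init (m + 1) hi) ?_
    have hprev := congrArg LocalState.history (ih i hi)
    rw [show m + 1 + 3 = (m + 3) + 1 by omega, Protocol.view_succ _ _ (m + 3),
      Protocol.view_succ _ _ m]
    simp only [← hprev, D2.consState]
    -- The history already has `m + 3` entries, so dropping three leaves the new round intact.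
    rw [List.drop_append_of_le_length (by simp), List.map_append]
    congr 1
    simp only [List.map_cons, List.map_nil]
    congr 1
    funext j
    rw [D2_msg_late (by omega), Protocol.msg_eq]
    by_cases hd : a.Delivers (m + 3) j i
    · have hj : ((3 : ℕ) : ℕ∞) < a.crashRound j :=
        Scenario.lt_crashRound_of_le (by omega) hd.1
      rw [if_pos ⟨hd, hact j⟩, if_pos ((inner_delivers_iff m j i).2 hd), ih j hj]
      cases C.send j (C.view (a.inner f) m j) i <;> rfl
    · rw [if_neg fun h => hd h.1, if_neg fun h => hd ((inner_delivers_iff m j i).1 h)]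
      rfl

/-- The decisions of D2 after time 2 are those of the consensus subroutine. -/
theorem D2_performs_late_iff (hact : ∀ i, Active a f i) (i : Fin n) (d : Decision) (m : ℕ) :
    (D2 f C).Performs a i d (m + 3) ↔ ((3 : ℕ) : ℕ∞) < a.crashRound i ∧ ErrAt a f i ∧
      ∃ b, C.Performs (a.inner f) i b m ∧ d = if b = true then .commit else .abort := by
  rw [D2_performs_iff]
  constructor
  · rintro ⟨hm, ⟨h, -⟩ | ⟨-, -, he, b, hb, hd⟩⟩
    · omega
    · have hi : ((3 : ℕ) : ℕ∞) < a.crashRound i := Scenario.lt_crashRound_of_le (by omega) hm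
      rw [consState_view hact m i hi] at hb
      exact ⟨hi, he, b, (Protocol.performs_iff ..).2 ⟨(inner_lt_crashRound_iff hi).2 hm, hb⟩, hd⟩
  · rintro ⟨hi, he, b, hb, hd⟩
    obtain ⟨hm, hb⟩ := (Protocol.performs_iff ..).1 hb
    refine ⟨(inner_lt_crashRound_iff hi).1 hm, .inr ⟨by omega, hact i, he, b, ?_, hd⟩⟩
    rw [consState_view hact m i hi, hb]

/-- Every decision of D2 is either a `commit` at time 2 or made by the consensus subroutine. -/
theorem D2_performs_cases {i : Fin n} {d : Decision} {m : ℕ} (h : (D2 f C).Performs a i d m) :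
    (¬ ErrAt a f i ∧ d = .commit) ∨
    ((∀ j, Active a f j) ∧ ErrAt a f i ∧ ((3 : ℕ) : ℕ∞) < a.crashRound i ∧
      ∃ b k, C.Performs (a.inner f) i b k ∧ d = if b = true then .commit else .abort) := by
  have h' := (D2_performs_iff ..).1 h
  rcases h' with ⟨hm, ⟨-, he, hd⟩ | ⟨h3, -, he, -⟩⟩
  · exact .inl ⟨he, hd⟩
  · have hi : ((3 : ℕ) : ℕ∞) < a.crashRound i := Scenario.lt_crashRound_of_le h3 hm
    have hact := active_of_errAt hi he
    obtain ⟨k, rfl⟩ := Nat.exists_eq_add_of_le' h3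
    obtain ⟨-, -, b, hb, hd⟩ := (D2_performs_late_iff hact i d k).1 h
    exact .inr ⟨hact, he, hi, b, k, hb, hd⟩

theorem inner_mem_consensusRuns (hfn : f < n) (ha : a ∈ context n f) {p : Fin n}
    (he : ErrAt a f p) :
    a.inner f ∈ consensusRuns n f := by
  refine ⟨?_, ?_⟩
  · have : {i | (a.inner f).Faulty i} = {i | a.Faulty i} := Set.ext fun i => inner_faulty_iff i
    simpa [context, this] using ha
  by_cases hall : ∀ i, ((3 : ℕ) : ℕ∞) < a.crashRound i
  · right
    have hdel : ∀ m < 3, ∀ j i, a.Delivers m j i := fun m hm j i =>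
      Scenario.delivers_of_succ_lt (Scenario.lt_crashRound_of_le (by omega) (hall j)) i
    intro i
    rw [← Bool.not_eq_true, inner_init_iff]
    obtain ⟨q, -, hq⟩ := he
    rintro ⟨-, hi | hi⟩
    · obtain ⟨j, -, hj⟩ := exists_missing hfn hq
      -- Without crashes so far, the `1` can be missing at `q` only because `j` has initial value
      -- `0`. Then `j` occurs in no id list, and the error from `q` reaches everybody.
      have hj0 : a.init j ≠ true := fun h => hj ⟨h, hdel 0 (by omega) j q⟩
      obtain ⟨k, -, -, hk⟩ := hi j
      exact hj0 (init_of_mem_heard hk)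
    · exact hi ⟨q, hdel 1 (by omega) q i, hq⟩
  · left
    push Not at hall
    obtain ⟨j, hj⟩ := hall
    exact ⟨j, inner_dead (not_lt.2 hj)⟩

/-- If some process commits at time 2, then a correct process proposes `1`. -/
theorem exists_correct_proposes_one (hfn : f < n) (ha : a ∈ context n f) {p : Fin n}
    (hp : ¬ ErrAt a f p) : ∃ i, ¬ (a.inner f).Faulty i ∧ (a.inner f).init i = true := by
  by_cases h : ∃ w, ¬ a.Faulty w ∧ ¬ ErrAt a f w
  · obtain ⟨w, hw, hew⟩ := h
    exact ⟨w, by rwa [inner_faulty_iff],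
      (inner_init_iff w).2 ⟨Scenario.lt_crashRound_of_not_faulty hw 3, .inr hew⟩⟩
  · push Not at h
    obtain ⟨w, hw⟩ := Scenario.exists_correct hfn ha
    refine ⟨w, by rwa [inner_faulty_iff],
      (inner_init_iff w).2 ⟨Scenario.lt_crashRound_of_not_faulty hw 3, .inl fun k => ?_⟩⟩
    obtain ⟨j, hj, hk⟩ := exists_correct_hearer hfn ha hp k
    exact ⟨j, Scenario.delivers_of_not_faulty hj _ _, h j hj, hk⟩

theorem D2_solvesAC (hfn : f < n) (hC : IsB1Consensus (consensusRuns n f) C) :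
    SolvesAC f (D2 f C) where
  decision a ha i hi := by
    by_cases he : ErrAt a f i
    · have h3 := Scenario.lt_crashRound_of_not_faulty hi 3
      obtain ⟨b, m, hb⟩ := hC.decision _ (inner_mem_consensusRuns hfn ha he) i
        (by rwa [inner_faulty_iff])
      exact ⟨_, m + 3,
        (D2_performs_late_iff (active_of_errAt h3 he) i _ m).2 ⟨h3, he, b, hb, rfl⟩⟩
    · exact ⟨.commit, 2, (D2_performs_iff ..).2
        ⟨Scenario.lt_crashRound_of_not_faulty hi 2, .inl ⟨rfl, he, rfl⟩⟩⟩
  agreement a ha i j d d' m m' h h' := by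
    rcases D2_performs_cases h with ⟨he, rfl⟩ | ⟨-, he, h3, b, k, hb, rfl⟩ <;>
      rcases D2_performs_cases h' with ⟨he', rfl⟩ | ⟨-, he', h3', b', k', hb', rfl⟩
    · rfl
    · rw [hC.biased _ (inner_mem_consensusRuns hfn ha he')
        (exists_correct_proposes_one hfn ha he) _ _ _ hb', if_pos rfl]
    · rw [hC.biased _ (inner_mem_consensusRuns hfn ha he)
        (exists_correct_proposes_one hfn ha he') _ _ _ hb, if_pos rfl]
    · rw [hC.agreement _ (inner_mem_consensusRuns hfn ha he) _ _ _ _ _ _ hb hb']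
  commitValidity a ha i m h k := by
    rcases D2_performs_cases h with ⟨he, -⟩ | ⟨-, he, h3, b, l, hb, hd⟩
    · exact init_of_not_errAt hfn ha he k
    · cases b with
      | false => simp at hd
      | true =>
        obtain ⟨j, hj⟩ := hC.validity _ (inner_mem_consensusRuns hfn ha he) _ _ _ hb
        rcases ((inner_init_iff j).1 hj).2 with hj | hj
        · obtain ⟨_, -, -, hk⟩ := hj k
          exact init_of_mem_heard hk
        · exact init_of_not_errAt hfn ha hj k
  abortValidity a ha i m h := by
    rcases D2_performs_cases h with ⟨-, hd⟩ | ⟨-, ⟨q, -, hq⟩, -⟩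
    · cases hd
    -- The source whose `1` is missing either failed or had initial value `0`.
    · obtain ⟨j, -, hj⟩ := exists_missing hfn hq
      by_cases hf : a.Faulty j
      · exact .inr ⟨j, hf⟩
      · exact .inl ⟨j, Bool.not_eq_true _ ▸ fun h =>
          hj ⟨h, Scenario.delivers_of_not_faulty hf _ _⟩⟩

end Inner

/-! ## Nice runs of D2 -/

section Nice

variable {f : ℕ} {C : Protocol n M Bool} {a : Scenario n}

theorem Scenario.Nice.not_errAt (ha : a.Nice) (hfn : f < n) (i : Fin n) : ¬ ErrAt a f i := by
  rintro ⟨q, -, hq⟩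
  obtain ⟨j, -, hj⟩ := exists_missing hfn hq
  exact hj ⟨ha.1 j, Scenario.delivers_of_not_faulty (ha.2 j) _ _⟩

theorem D2_performs_iff_of_nice (ha : a.Nice) (hfn : f < n) (i : Fin n) (d : Decision) (m : ℕ) :
    (D2 f C).Performs a i d m ↔ d = .commit ∧ m = 2 := by
  rw [D2_performs_iff]
  simp only [ha.not_errAt hfn i, Scenario.lt_crashRound_of_not_faulty (ha.2 i) m, true_and,
    not_false_eq_true, false_and, and_false, or_false]
  tauto

theorem D2_send_zero_ne_none {s : LocalState n (D2Msg n M)} (h : s.time = 0) (i j : Fin n) :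
    (D2 f C).send i s j ≠ none ↔ s.init = true ∧ D2.IsTarget f i j := by
  simp [D2, h]

theorem D2_sends_iff_of_nice (ha : a.Nice) (hfn : f < n) (m : ℕ) (i j : Fin n) :
    (D2 f C).Sends a m i j ↔ m = 0 ∧ D2.IsTarget f i j := by
  rw [Protocol.sends_iff]
  have hdel := fun m => Scenario.delivers_of_not_faulty (ha.2 i) m j
  match m with
  | 0 =>
    rw [Protocol.msg_of_delivers _ _ (hdel 0), D2_send_zero_ne_none (by simp)]
    simp [ha.1 i]
  | 1 =>
    have : ¬ (heard a f i).card < f + 1 :=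
      fun h => ha.not_errAt hfn j ⟨i, hdel 1, h⟩
    rw [D2_msg_one, if_neg fun h => this h.2]
    simp
  | 2 =>
    rw [D2_msg_two, if_neg fun h => ha.not_errAt hfn _ h.2]
    simp
  | m + 3 =>
    have : ¬ Active a f i := fun ⟨k, _, h⟩ => ha.not_errAt hfn _ h
    rw [D2_msg_late (by omega), if_neg fun h => this h.2]
    simp

/-- Only round 1 has messages. Each process has `f + 1` targets, but one of them is itself. -/
theorem D2_messageCount_of_nice (ha : a.Nice) (hfn : f < n) :
    (D2 f C).messageCount a = ((f * n : ℕ) : ℕ∞) := by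
  classical
  have hset : {e : ℕ × Fin n × Fin n | e.2.1 ≠ e.2.2 ∧ (D2 f C).Sends a e.1 e.2.1 e.2.2} =
      ((({0} : Finset ℕ) ×ˢ (Finset.univ.sigma fun i : Fin n =>
        (Finset.univ.filter fun j => D2.IsTarget f i j).erase i).map
          (Equiv.sigmaEquivProd (Fin n) (Fin n)).toEmbedding : Finset (ℕ × Fin n × Fin n)) :
            Set (ℕ × Fin n × Fin n)) := by
    ext ⟨m, i, j⟩
    simp [D2_sends_iff_of_nice ha hfn, Equiv.sigmaEquivProd]
    tauto
  rw [Protocol.messageCount, hset, Set.encard_coe_eq_coe_finsetCard]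
  congr 1
  rw [Finset.card_product, Finset.card_map, Finset.card_sigma]
  have : ∀ i : Fin n, ((Finset.univ.filter fun j => D2.IsTarget f i j).erase i).card = f := by
    intro i
    rw [Finset.card_erase_of_mem (by simp [D2.isTarget_self]), D2.card_targets hfn]
    rfl
  simp [this, mul_comm]

end Nice

/-! ## Lower bounds -/

section LowerBound

variable {f : ℕ} {P : Protocol n M Decision}

/-- In a nice run only `commit` is performed. -/
theorem SolvesAC.eq_commit_of_nice (hP : SolvesAC f P) {a : Scenario n} (ha : a.Nice) {i : Fin n}
    {d : Decision} {m : ℕ} (h : P.Performs a i d m) : d = .commit := by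
  cases d with
  | commit => rfl
  | abort =>
    rcases hP.abortValidity a (ha.mem_context f) i m h with ⟨j, hj⟩ | ⟨j, hj⟩
    · simp [ha.1 j] at hj
    · exact absurd hj (ha.2 j)

/-- If `commit` is performed in a run and a correct process cannot distinguish it from a run with
the initial value `0`, then the protocol does not solve atomic commitment. -/
theorem SolvesAC.false_of_indistinguishable (hP : SolvesAC f P) {a b : Scenario n}
    (ha : a ∈ context n f) (hb : b ∈ context n f) {i w z : Fin n} {m : ℕ}
    (hi : P.Performs a i .commit m) (hz : b.init z = false)
    (hwa : ¬ a.Faulty w) (hwb : ¬ b.Faulty w) (hw : ∀ m, P.view a m w = P.view b m w) : False := by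
  obtain ⟨d, k, hd⟩ := hP.decision a ha w hwa
  obtain rfl := hP.agreement a ha _ _ _ _ _ _ hi hd
  have : P.Performs b w .commit k := by
    rw [Protocol.performs_iff] at hd ⊢
    exact ⟨Scenario.lt_crashRound_of_not_faulty hwb k, hw k ▸ hd.2⟩
  simp [hP.commitValidity b hb w k this z] at hz

/-- A run described by its initial values and its crashes, where `none` means no crash and
`some (m, S)` means a crash in round `m + 1` in which exactly the messages to `S` get through. -/
def Scenario.ofCrash (v : Fin n → Bool) (c : Fin n → Option (ℕ × Set (Fin n))) : Scenario n where
  init := v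
  crashRound i := (c i).elim ⊤ fun p => ((p.1 + 1 : ℕ) : ℕ∞)
  one_le_crashRound i := by
    cases c i with
    | none => simp
    | some p => simp
  reached i := (c i).elim ∅ Prod.snd

section OfCrash

variable {v : Fin n → Bool} {c : Fin n → Option (ℕ × Set (Fin n))}

theorem ofCrash_faulty_iff (i : Fin n) : (Scenario.ofCrash v c).Faulty i ↔ c i ≠ none := by
  cases h : c i with
  | none => simp [Scenario.Faulty, Scenario.ofCrash, h]
  | some p =>
    refine iff_of_true ?_ (by simp)
    simp only [Scenario.Faulty, Scenario.ofCrash, h, Option.elim_some]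
    exact ENat.natCast_ne_top _

theorem ofCrash_lt_crashRound_iff (m : ℕ) (i : Fin n) :
    (m : ℕ∞) < (Scenario.ofCrash v c).crashRound i ↔ ∀ p ∈ c i, m ≤ p.1 := by
  cases h : c i with
  | none =>
    simp only [Scenario.ofCrash, h, Option.elim_none]
    exact iff_of_true (ENat.natCast_lt_top m) (by simp)
  | some p =>
    simp only [Scenario.ofCrash, h, Option.elim_some]
    rw [ENat.natCast_lt_natCast]
    simp

theorem ofCrash_delivers_iff (m : ℕ) (j i : Fin n) :
    (Scenario.ofCrash v c).Delivers m j i ↔ ∀ p ∈ c j, m < p.1 ∨ m = p.1 ∧ i ∈ p.2 := by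
  unfold Scenario.Delivers
  rw [ofCrash_lt_crashRound_iff]
  cases h : c j with
  | none =>
    simp only [Scenario.ofCrash, h, Option.elim_none, ENat.top_ne_natCast]
    simp
  | some p =>
    simp only [Scenario.ofCrash, h, Option.elim_some, Option.mem_def, Option.some.injEq,
      forall_eq']
    rw [Nat.cast_inj]
    constructor
    · rintro ⟨h1, h2⟩
      rcases h1.lt_or_eq with h1 | h1
      · exact .inl h1
      · exact .inr ⟨h1, h2 (by omega)⟩
    · rintro (h1 | ⟨h1, h2⟩)
      · exact ⟨h1.le, fun _ => by omega⟩
      · exact ⟨h1.le, fun _ => h2⟩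

theorem ofCrash_mem_context {s : Finset (Fin n)} (hs : s.card ≤ f)
    (h : ∀ i ∉ s, c i = none) : Scenario.ofCrash v c ∈ context n f := by
  refine le_trans (Set.ncard_le_ncard (t := (s : Set (Fin n))) (fun i hi => ?_) (Set.toFinite _))
    (by rwa [Set.ncard_coe_finset])
  by_contra hi'
  exact (ofCrash_faulty_iff i).1 hi (h i hi')

end OfCrash

theorem view_one_congr {a b : Scenario n} {i : Fin n} (h0 : ∀ j, a.init j = b.init j)
    (h : ∀ j, a.Delivers 0 j i ↔ b.Delivers 0 j i) : P.view a 1 i = P.view b 1 i :=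
  Protocol.view_succ_congr (by simp [Protocol.view_zero, h0])
    fun j => Protocol.msg_congr (by simp [Protocol.view_zero, h0]) (h j)

/-- If more than one process may crash, nobody decides before time 2 in a nice run. -/
theorem SolvesAC.two_le_of_nice (hP : SolvesAC f P) (hn : 2 < n) (hf : 1 < f) {a : Scenario n}
    (ha : a.Nice) {i : Fin n} {d : Decision} {m : ℕ} (h : P.Performs a i d m) : 2 ≤ m := by
  classical
  by_contra! hm
  obtain rfl := hP.eq_commit_of_nice ha h
  have : Nontrivial (Fin n) := Fin.nontrivial_iff_two_le.2 (by omega)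
  obtain ⟨j, hji⟩ := exists_ne i
  obtain ⟨w, hw⟩ : ∃ w, w ∉ ({i, j} : Finset (Fin n)) := by
    by_contra! hc
    have h1 := Finset.card_le_card (s := Finset.univ) fun x _ => hc x
    have h2 := Finset.card_le_two (a := i) (b := j)
    rw [Finset.card_univ, Fintype.card_fin] at h1
    omega
  simp only [Finset.mem_insert, Finset.mem_singleton, not_or] at hw
  -- In both runs `i` crashes after time 1 and `j` is dead, except that it reaches `i` in `b`.
  let cr (S : Set (Fin n)) : Fin n → Option (ℕ × Set (Fin n)) := fun k =>
    if k = i then some (1, ∅) else if k = j then some (0, S) else none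
  have cri (S) : cr S i = some (1, ∅) := by simp [cr]
  have crj (S) : cr S j = some (0, S) := by simp [cr, hji]
  have crk (S) {k} (h1 : k ≠ i) (h2 : k ≠ j) : cr S k = none := by simp [cr, h1, h2]
  let b := Scenario.ofCrash (fun _ => true) (cr {i})
  let e := Scenario.ofCrash (fun k => decide (k ≠ j)) (cr ∅)
  have hmem : ∀ v S, Scenario.ofCrash v (cr S) ∈ context n f := fun v S =>
    ofCrash_mem_context (s := {i, j}) (Finset.card_le_two.trans hf) fun k hk => by
      simp only [Finset.mem_insert, Finset.mem_singleton, not_or] at hk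
      exact crk S hk.1 hk.2
  have hcorr : ∀ v S {k}, k ≠ i → k ≠ j → ¬ (Scenario.ofCrash v (cr S)).Faulty k :=
    fun v S k h1 h2 h => (ofCrash_faulty_iff k).1 h (crk S h1 h2)
  -- By time 1 nothing is lost on the way to `i`: the only interrupted sender `j` reaches exactly
  -- `i`.
  have hview : P.view a m i = P.view b m i := by
    interval_cases m
    · simp [Protocol.view_zero, ha.1, b, Scenario.ofCrash]
    · refine view_one_congr (fun k => ha.1 k) fun k => iff_of_true
        (Scenario.delivers_of_not_faulty (ha.2 k) _ _) ((ofCrash_delivers_iff ..).2 ?_)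
      by_cases h1 : k = i
      · simp [h1, cri]
      · by_cases h2 : k = j
        · simp [h2, crj]
        · simp [crk _ h1 h2]
  have hb : P.Performs b i .commit m := by
    rw [Protocol.performs_iff] at h ⊢
    refine ⟨(ofCrash_lt_crashRound_iff ..).2 ?_, hview ▸ h.2⟩
    simp [cri]; omega
  -- Only `j` differs initially, and only `i` can learn of it in round 1; but `i` crashes in round 2
  -- without sending.
  have key : ∀ m, ∀ k, k ≠ j → (1 ≤ m → k ≠ i) → P.view b m k = P.view e m k := by
    intro m
    induction m with
    | zero => intro k hk _; simp [Protocol.view_zero, b, e, Scenario.ofCrash, hk]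
    | succ m ih =>
      intro k hk hki
      replace hki := hki (by omega)
      refine Protocol.view_succ_congr (ih k hk fun _ => hki) fun l => ?_
      by_cases hl : l = j ∨ 1 ≤ m ∧ l = i
      · rw [Protocol.msg_of_not_delivers, Protocol.msg_of_not_delivers] <;>
          rw [ofCrash_delivers_iff] <;> rcases hl with rfl | ⟨hl, rfl⟩ <;>
          simp [crj, cri] <;> first | exact fun _ => hki | omega
      · push Not at hl
        refine Protocol.msg_congr (ih l hl.1 hl.2) ?_
        rw [ofCrash_delivers_iff, ofCrash_delivers_iff]
        by_cases h1 : l = i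
        · simp [h1, cri]
        · simp [crk _ h1 hl.1]
  exact hP.false_of_indistinguishable (hmem _ _) (hmem _ _) hb (z := j) (w := w)
    (by simp [Scenario.ofCrash]) (hcorr _ _ hw.1 hw.2) (hcorr _ _ hw.1 hw.2)
    fun m => key m w hw.2 fun _ => hw.1

/-- In a nice run in which `i` decides by time 2, it sends messages to at least `f` other processes
in the first two rounds. -/
theorem SolvesAC.le_card_recipients (hP : SolvesAC f P) (hfn : f < n) {a : Scenario n}
    (ha : a.Nice) {i : Fin n} {d : Decision} {m : ℕ} (hm : m ≤ 2) (h : P.Performs a i d m)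
    {T U : Finset (Fin n)} (hT : ∀ j, j ∈ T ↔ j ≠ i ∧ P.Sends a 0 i j)
    (hU : ∀ j, j ∈ U ↔ j ≠ i ∧ P.Sends a 1 i j) : f ≤ (T ∪ U).card := by
  classical
  by_contra! hlt
  obtain rfl := hP.eq_commit_of_nice ha h
  -- By assumption `i` has fewer than `f` recipients, so all of them and `i` itself may crash.
  have hX : (insert i (T ∪ U)).card ≤ f := (Finset.card_insert_le _ _).trans hlt
  obtain ⟨w, hw⟩ : ∃ w, w ∉ insert i (T ∪ U) := by
    by_contra! hc
    have h1 := Finset.card_le_card (s := Finset.univ) fun x _ => hc x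
    rw [Finset.card_univ, Fintype.card_fin] at h1
    omega
  have hiT : i ∉ T := fun h => ((hT i).1 h).1 rfl
  -- The processes reached by `i` crash in rounds 2 and 3 without reaching the others. In `b`
  -- process `i` commits and crashes in round 3, in `e` it is dead and has initial value `0`.
  let cr (q : ℕ) (S : Set (Fin n)) : Fin n → Option (ℕ × Set (Fin n)) := fun k =>
    if k = i then some (q, ∅) else if k ∈ T then some (1, S) else if k ∈ U then some (2, ∅)
    else none
  have cri (q S) : cr q S i = some (q, ∅) := by simp [cr]
  have crT (q S) {k} (h1 : k ∈ T) : cr q S k = some (1, S) := by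
    have : k ≠ i := fun e => hiT (e ▸ h1)
    simp [cr, h1, this]
  have crU (q S) {k} (h0 : k ≠ i) (h1 : k ∉ T) (h2 : k ∈ U) : cr q S k = some (2, ∅) := by
    simp [cr, h0, h1, h2]
  have crk (q S) {k} (hk : k ∉ insert i (T ∪ U)) : cr q S k = none := by
    simp only [Finset.mem_insert, Finset.mem_union, not_or] at hk
    simp [cr, hk]
  let b := Scenario.ofCrash (fun _ => true) (cr 2 {i})
  let e := Scenario.ofCrash (fun k => decide (k ≠ i)) (cr 0 ∅)
  have hmem : ∀ v q S, Scenario.ofCrash v (cr q S) ∈ context n f := fun v q S =>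
    ofCrash_mem_context hX fun k hk => crk q S hk
  have hcorr : ∀ v q S, ¬ (Scenario.ofCrash v (cr q S)).Faulty w :=
    fun v q S h => (ofCrash_faulty_iff w).1 h (crk q S hw)
  have hdel0 : ∀ k l, b.Delivers 0 k l := by
    intro k l
    rw [ofCrash_delivers_iff]
    by_cases h1 : k = i
    · simp [h1, cri]
    · by_cases h2 : k ∈ T
      · simp [crT _ _ h2]
      · by_cases h3 : k ∈ U
        · simp [crU _ _ h1 h2 h3]
        · simp [cr, h1, h2, h3]
  have hdel1 : ∀ k l, b.Delivers 1 k l ↔ k ∈ T → l = i := by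
    intro k l
    rw [ofCrash_delivers_iff]
    by_cases h1 : k = i
    · simp [h1, cri, hiT]
    · by_cases h2 : k ∈ T
      · simp [crT _ _ h2, h2]
      · by_cases h3 : k ∈ U
        · simp [crU _ _ h1 h2 h3, h2]
        · simp [cr, h1, h2, h3]
  have hda : ∀ m k l, a.Delivers m k l := fun m k l =>
    Scenario.delivers_of_not_faulty (ha.2 k) m l
  have hview0 : ∀ k, P.view a 0 k = P.view b 0 k := by
    intro k; simp [Protocol.view_zero, ha.1, b, Scenario.ofCrash]
  have hview1 : ∀ k, P.view a 1 k = P.view b 1 k := fun k =>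
    view_one_congr (fun k => ha.1 k) fun l => iff_of_true (hda _ _ _) (hdel0 _ _)
  -- This is why `T` reaches `i` in round 2 of `b`: at time 2 process `i` must still see a nice run.
  have hview2 : P.view a 2 i = P.view b 2 i :=
    Protocol.view_succ_congr (hview1 i) fun k =>
      Protocol.msg_congr (hview1 k) (iff_of_true (hda _ _ _) ((hdel1 _ _).2 fun _ => rfl))
  have hb : P.Performs b i .commit m := by
    rw [Protocol.performs_iff] at h ⊢
    refine ⟨(ofCrash_lt_crashRound_iff ..).2 ?_, ?_⟩
    · simpa [cri] using hm
    · interval_cases m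
      · exact hview0 i ▸ h.2
      · exact hview1 i ▸ h.2
      · exact hview2 ▸ h.2
  -- `T` and `U` were read off the nice run `a`; since `i` has the same views in `b`, its recipients
  -- there are the same.
  have hi0 : ∀ k, k ≠ i → k ∉ T → P.msg b 0 i k = none := by
    intro k h1 h2
    have : ¬ P.Sends a 0 i k := fun h => h2 ((hT k).2 ⟨h1, h⟩)
    rw [Protocol.sends_iff, not_not] at this
    rwa [← Protocol.msg_congr (hview0 i) (iff_of_true (hda _ _ _) (hdel0 _ _))]
  have hi1 : ∀ k, k ≠ i → k ∉ U → P.msg b 1 i k = none := by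
    intro k h1 h2
    have : ¬ P.Sends a 1 i k := fun h => h2 ((hU k).2 ⟨h1, h⟩)
    rw [Protocol.sends_iff, not_not] at this
    rwa [← Protocol.msg_congr (hview1 i)
      (iff_of_true (hda _ _ _) ((hdel1 _ _).2 fun h => absurd h hiT))]
  have hei : ∀ m k, ¬ e.Delivers m i k := by
    intro m k
    rw [ofCrash_delivers_iff]
    simp [cri]
  -- Knowledge of the difference stays confined: to `T` from time 1 and `U` from time 2. Each of
  -- these processes crashes in a later round, before passing anything on to an outsider.
  have key : ∀ m, ∀ k, k ≠ i → (1 ≤ m → k ∉ T) → (2 ≤ m → k ∉ U) →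
      P.view b m k = P.view e m k := by
    intro m
    induction m with
    | zero => intro k hk _ _; simp [Protocol.view_zero, b, e, Scenario.ofCrash, hk]
    | succ m ih =>
      intro k hk hkT hkU
      replace hkT := hkT (by omega)
      refine Protocol.view_succ_congr (ih k hk (fun _ => hkT) fun h => hkU (by omega)) fun l => ?_
      by_cases hli : l = i
      · subst hli
        rw [Protocol.msg_of_not_delivers P e (hei m k)]
        match m with
        | 0 => exact hi0 k hk hkT
        | 1 => exact hi1 k hk (hkU (by omega))
        | m + 2 =>
          refine Protocol.msg_of_not_delivers _ _ ?_
          rw [ofCrash_delivers_iff]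
          simp [cri]
      by_cases hlT : l ∈ T
      · rcases Nat.eq_zero_or_pos m with rfl | hm
        · refine Protocol.msg_congr (ih l hli (by omega) (by omega)) ?_
          rw [ofCrash_delivers_iff, ofCrash_delivers_iff]
          simp [crT _ _ hlT]
        · rw [Protocol.msg_of_not_delivers, Protocol.msg_of_not_delivers] <;>
            rw [ofCrash_delivers_iff] <;> simp [crT _ _ hlT, hk] <;> omega
      by_cases hlU : l ∈ U
      · rcases lt_or_ge m 2 with hm | hm
        · refine Protocol.msg_congr (ih l hli (fun _ => hlT) (by omega)) ?_
          rw [ofCrash_delivers_iff, ofCrash_delivers_iff]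
          simp [crU _ _ hli hlT hlU]
        · rw [Protocol.msg_of_not_delivers, Protocol.msg_of_not_delivers] <;>
            rw [ofCrash_delivers_iff] <;> simp [crU _ _ hli hlT hlU] <;> omega
      · refine Protocol.msg_congr (ih l hli (fun _ => hlT) fun _ => hlU) ?_
        rw [ofCrash_delivers_iff, ofCrash_delivers_iff]
        simp [cr, hli, hlT, hlU]
  simp only [Finset.mem_insert, Finset.mem_union, not_or] at hw
  exact hP.false_of_indistinguishable (hmem _ _ _) (hmem _ _ _) hb (z := i) (w := w)
    (by simp [Scenario.ofCrash]) (hcorr _ _ _) (hcorr _ _ _)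
    fun m => key m w hw.1 (fun _ => hw.2.1) fun _ => hw.2.2

/-- If all processes decide by time 2 in a nice run, then at least `f * n` messages are sent. -/
theorem SolvesAC.le_messageCount (hP : SolvesAC f P) (hfn : f < n) {a : Scenario n}
    (ha : a.Nice) (h : ∀ i, ∃ d, ∃ m ≤ 2, P.Performs a i d m) :
    ((f * n : ℕ) : ℕ∞) ≤ P.messageCount a := by
  classical
  let R (m : ℕ) (i : Fin n) : Finset (Fin n) := {j | j ≠ i ∧ P.Sends a m i j}
  have hR : ∀ m i j, j ∈ R m i ↔ j ≠ i ∧ P.Sends a m i j := by simp [R]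
  have hf : ∀ i, f ≤ (R 0 i ∪ R 1 i).card := fun i => by
    obtain ⟨d, m, hm, hd⟩ := h i
    exact hP.le_card_recipients hfn ha hm hd (hR 0 i) (hR 1 i)
  let E : Finset (Fin n × Fin n) := {p | p.2 ∈ R 0 p.1 ∪ R 1 p.1}
  have hE : f * n ≤ E.card := by
    have : E = (Finset.univ.sigma fun i => R 0 i ∪ R 1 i).map
        (Equiv.sigmaEquivProd (Fin n) (Fin n)).toEmbedding := by
      ext ⟨i, j⟩
      simp [E, Equiv.sigmaEquivProd]
    rw [this, Finset.card_map, Finset.card_sigma]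
    calc f * n = ∑ _i : Fin n, f := by simp [mul_comm]
      _ ≤ _ := Finset.sum_le_sum fun i _ => hf i
  -- Forgetting the round maps the messages onto a superset of `E`, so a pair used in both rounds is
  -- counted only once.
  have hsub : (E : Set (Fin n × Fin n)) ⊆ Prod.snd ''
      {e : ℕ × Fin n × Fin n | e.2.1 ≠ e.2.2 ∧ P.Sends a e.1 e.2.1 e.2.2} := by
    rintro ⟨i, j⟩ hij
    simp only [E, Finset.coe_filter, Finset.mem_union, hR, Set.mem_ofPred_eq, Finset.mem_univ,
      true_and] at hij
    rcases hij with ⟨h1, h2⟩ | ⟨h1, h2⟩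
    · exact ⟨(0, i, j), ⟨h1.symm, h2⟩, rfl⟩
    · exact ⟨(1, i, j), ⟨h1.symm, h2⟩, rfl⟩
  calc ((f * n : ℕ) : ℕ∞) ≤ (E.card : ℕ∞) := by exact_mod_cast hE
    _ = (E : Set (Fin n × Fin n)).encard := (Set.encard_coe_eq_coe_finsetCard E).symm
    _ ≤ _ := (Set.encard_le_encard hsub).trans (Set.encard_image_le _ _)

end LowerBound

end AtomicCommit

theorem mainTheorem4 (n f : ℕ) (hn : 2 < n) (hf : 1 ≤ f) (hfn : f < n) :
    -- the subroutine `B.1.Consensus(f - 1, ·)` is what its name says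
    AtomicCommit.IsB1Consensus (AtomicCommit.context n (f - 1)) (AtomicCommit.flood n (f - 1)) ∧
    -- D2 with this subroutine solves atomic commitment in `γ^f`
    AtomicCommit.SolvesAC f (AtomicCommit.D2 f (AtomicCommit.flood n (f - 1))) ∧
    -- so does D2 with any other subroutine that solves biased-to-1 uniform consensus
    (∀ (M : Type*) (C : AtomicCommit.Protocol n M Bool),
      AtomicCommit.IsB1Consensus (AtomicCommit.consensusRuns n f) C →
      AtomicCommit.SolvesAC f (AtomicCommit.D2 f C)) ∧
    -- nice runs of D2: exactly `f * n` messages, and the decisions performed are exactly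
    -- one `commit` of every process, at time 2
    (∀ (M : Type*) (C : AtomicCommit.Protocol n M Bool) (a : AtomicCommit.Scenario n), a.Nice →
      (AtomicCommit.D2 f C).messageCount a = ((f * n : ℕ) : ℕ∞) ∧
      ∀ i d m, (AtomicCommit.D2 f C).Performs a i d m ↔ d = .commit ∧ m = 2) ∧
    -- matching lower bounds for every atomic commitment protocol in `γ^f`
    (∀ (M : Type*) (P : AtomicCommit.Protocol n M AtomicCommit.Decision),
      AtomicCommit.SolvesAC f P → ∀ a : AtomicCommit.Scenario n, a.Nice →
      (1 < f → ∀ i d m, P.Performs a i d m → 2 ≤ m) ∧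
      ((∀ i, ∃ d, ∃ m ≤ 2, P.Performs a i d m) →
        ((f * n : ℕ) : ℕ∞) ≤ P.messageCount a)) := by
  refine ⟨AtomicCommit.flood_isB1Consensus_context n (f - 1),
    AtomicCommit.D2_solvesAC hfn (AtomicCommit.flood_isB1Consensus_consensusRuns n f),
    fun M C hC => AtomicCommit.D2_solvesAC hfn hC,
    fun M C a ha => ⟨AtomicCommit.D2_messageCount_of_nice ha hfn,
      AtomicCommit.D2_performs_iff_of_nice ha hfn⟩,
    fun M P hP a ha => ⟨fun hf1 i d m h => hP.two_le_of_nice hn hf1 ha h,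
      fun h => hP.le_messageCount hfn ha h⟩⟩
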